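/- Let $M$ be a set, $\mathfrak{A}(M)$ a $\sigma$-algebra of subsets of $M$, $\mathcal{I}\subseteq\mathfrak{A}(M)$ a $\sigma$-ideal and $\mathfrak{A}=\mathfrak{A}(M)/\mathcal{I}$ the quotient Boolean $\sigma$-algebra (sets are identified if their symmetric difference is in $\mathcal{I}$). For $\mathbb{K}=\mathbb{R},\mathbb{C}$ let $\mathcal{F}_{\mathfrak{A}(M)}(M,\mathbb{K})$ be the algebra of bounded $\mathfrak{A}(M)$-measurable functions $M\to\mathbb{K}$ with the supremum norm, let $\mathcal{F}(\mathcal{I})\subseteq\mathcal{F}_{\mathfrak{A}(M)}(M,\mathbb{C})$ be the closed ideal of the functions that vanish outside some $A\in\mathcal{I}$, and let $\mathcal{F}_{\mathbb{R}}(\mathcal{I})=\mathcal{F}(\mathcal{I})\cap\mathcal{F}_{\mathfrak{A}(M)}(M,\mathbb{R})$. For a bounded lattice $\mathbb{L}$ let $\mathcal{Q}(\mathbb{L})$ be its Stone spectrum: the set of all quasipoints (maximal proper dual ideals) of $\mathbb{L}$, with the topology generated by the sets $\{\mathfrak{B}\mid a\in\mathfrak{B}\}$, $a\in\mathbb{L}$.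 A bounded spectral family in $\mathbb{L}$ is an increasing map $E:\mathbb{R}\to\mathbb{L}$ with $E_\lambda=\bigwedge_{\mu>\lambda}E_\mu$ for all $\lambda$, $\bigwedge_\lambda E_\lambda=0$, $\bigvee_\lambda E_\lambda=1$, such that $E_\lambda=0$ for $\lambda<a$ and $E_\lambda=1$ for $\lambda\ge b$ for some $a,b\in\mathbb{R}$; its associated function is $f_E(\mathfrak{B})=\inf\{\lambda\in\mathbb{R}\mid E_\lambda\in\mathfrak{B}\}$ for $\mathfrak{B}\in\mathcal{Q}(\mathbb{L})$. For $\varphi\in\mathcal{F}_{\mathfrak{A}(M)}(M,\mathbb{R})$ put $E^{\varphi}_\lambda=\varphi^{-1}(]-\infty,\lambda])\in\mathfrak{A}(M)$ and $E^{[\varphi]}_\lambda=[E^{\varphi}_\lambda]\in\mathfrak{A}$, which depends only on the class $[\varphi]=\varphi+\mathcal{F}_{\mathbb{R}}(\mathcal{I})$. Then: 1. The canonical map $\mathcal{F}_{\mathfrak{A}(M)}(M,\mathbb{R})/\mathcal{F}_{\mathbb{R}}(\mathcal{I})\to\mathcal{F}_{\mathfrak{A}(M)}(M,\mathbb{C})/\mathcal{F}(\mathcal{I})$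 is injective, and its image is the selfadjoint part of this $C^*$-algebra. 2. $E^{\varphi}$ and $E^{[\varphi]}$ are bounded spectral families in $\mathfrak{A}(M)$ and $\mathfrak{A}$, respectively, for every $\varphi\in\mathcal{F}_{\mathfrak{A}(M)}(M,\mathbb{R})$. 3. Each $f_{E^{[\varphi]}}$ is continuous, and up to a homeomorphism $\theta$ from $\mathcal{Q}(\mathfrak{A})$ onto the Gelfand spectrum of $\mathcal{F}_{\mathfrak{A}(M)}(M,\mathbb{C})/\mathcal{F}(\mathcal{I})$, the Gelfand transformation of this $C^*$-algebra, restricted to the selfadjoint part, is the map $$\Gamma:\mathcal{F}_{\mathfrak{A}(M)}(M,\mathbb{R})/\mathcal{F}_{\mathbb{R}}(\mathcal{I})\to C(\mathcal{Q}(\mathfrak{A}),\mathbb{R}),\qquad [\varphi]\mapsto f_{E^{[\varphi]}},$$ that is, $\theta(\mathfrak{B})([\varphi])=f_{E^{[\varphi]}}(\mathfrak{B})$ for all $\varphi$ and all $\mathfrak{B}\in\mathcal{Q}(\mathfrak{A})$. 4. The map $\mathfrak{B}\mapsto\{A\in\mathfrak{A}(M)\mid[A]\in\mathfrak{B}\}$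 is a homeomorphism $e$ from $\mathcal{Q}(\mathfrak{A})$ onto the subspace of those quasipoints of $\mathfrak{A}(M)$ that contain the complement of every $A\in\mathcal{I}$. Up to a homeomorphism from $\mathcal{Q}(\mathfrak{A}(M))$ onto the Gelfand spectrum of $\mathcal{F}_{\mathfrak{A}(M)}(M,\mathbb{C})$, the map $\varphi\mapsto f_{E^{\varphi}}$ is the Gelfand transformation on $\mathcal{F}_{\mathfrak{A}(M)}(M,\mathbb{R})$. With $\mathcal{Q}(\mathfrak{A})$ regarded as a subset of $\mathcal{Q}(\mathfrak{A}(M))$ through $e$, $f_{E^{[\varphi]}}$ is the restriction of $f_{E^{\varphi}}$, i.e. $f_{E^{[\varphi]}}(\mathfrak{B})=f_{E^{\varphi}}(e(\mathfrak{B}))$ for all $\varphi$ and all $\mathfrak{B}\in\mathcal{Q}(\mathfrak{A})$. -/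

import Mathlib

open scoped ENNReal

namespace ClassicalObservables

/-! ### Stone spectrum, spectral families and their associated functions -/

section Lattice

variable {L : Type*} [Lattice L] [BoundedOrder L]

/-- The Stone spectrum of a bounded lattice: its elements are the quasipoints, that is, the
maximal proper dual ideals of the lattice. -/
def StoneSpectrum (L : Type*) [Lattice L] [BoundedOrder L] : Type _ :=
  {F : Order.PFilter L // Maximal (fun G : Order.PFilter L => (⊥ : L) ∉ G) F}

/-- `a` belongs to the quasipoint `B`. -/
instance : Membership L (StoneSpectrum L) := ⟨fun B a => a ∈ B.1⟩

/-- The topology of the Stone spectrum, generated by the sets of all quasipoints that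
contain `a`, where `a` runs through the lattice. -/
instance : TopologicalSpace (StoneSpectrum L) :=
  TopologicalSpace.generateFrom (Set.range fun a : L => {B : StoneSpectrum L | a ∈ B})

/-- Spectral families: increasing, continuous from the right, with meet `0` and join `1`. -/
structure IsSpectralFamily (E : ℝ → L) : Prop where
  mono : Monotone E
  rightCont : ∀ t : ℝ, IsGLB (E '' Set.Ioi t) (E t)
  inf_eq : IsGLB (Set.range E) ⊥
  sup_eq : IsLUB (Set.range E) ⊤

/-- Bounded spectral families: `E` is `0` to the left and `1` to the right of some bounded
interval. -/
structure IsBoundedSpectralFamily (E : ℝ → L) : Prop extends IsSpectralFamily E where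
  bounded : ∃ a b : ℝ, (∀ t < a, E t = ⊥) ∧ (∀ t, b ≤ t → E t = ⊤)

/-- The function `f_E` on the Stone spectrum associated to `E`. -/
noncomputable def assocFun (E : ℝ → L) (B : StoneSpectrum L) : ℝ :=
  sInf {t : ℝ | E t ∈ B}

end Lattice

/-! ### The quotient of a Boolean algebra by an ideal -/

section Quotient

variable {A : Type*} [BooleanAlgebra A] (I : Order.Ideal A)

theorem symmDiff_mem_iff {a b : A} : symmDiff a b ∈ I ↔ a \ b ∈ I ∧ b \ a ∈ I := by
  rw [symmDiff, Order.Ideal.sup_mem_iff]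

theorem sdiff_mem_trans {a b c : A} (h : a \ b ∈ I) (k : b \ c ∈ I) : a \ c ∈ I :=
  I.lower (sdiff_triangle a b c) (Order.Ideal.sup_mem h k)

theorem sup_sdiff_sup_le (a b c d : A) : (a ⊔ c) \ (b ⊔ d) ≤ (a \ b) ⊔ (c \ d) := by
  rw [sup_sdiff]
  exact sup_le_sup (sdiff_le_sdiff_left le_sup_left) (sdiff_le_sdiff_left le_sup_right)

theorem inf_sdiff_inf_le (a b c d : A) : (a ⊓ c) \ (b ⊓ d) ≤ (a \ b) ⊔ (c \ d) := by
  rw [sdiff_inf]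
  exact sup_le_sup (sdiff_le_sdiff_right inf_le_left) (sdiff_le_sdiff_right inf_le_right)

/-- Two elements are equivalent modulo `I` if their symmetric difference belongs to `I`. -/
def idealSetoid : Setoid A where
  r a b := symmDiff a b ∈ I
  iseqv :=
    { refl := fun a => by simp
      symm := fun {a b} h => by rwa [symmDiff_comm]
      trans := fun {a b c} h k => by
        rw [symmDiff_mem_iff] at *
        exact ⟨sdiff_mem_trans I h.1 k.1, sdiff_mem_trans I k.2 h.2⟩ }

/-- The quotient of the Boolean algebra `A` modulo the ideal `I`. -/
def BoolQuotient : Type _ := Quotient (idealSetoid I)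

namespace BoolQuotient

/-- The equivalence class of `a` modulo `I`. -/
def mk (a : A) : BoolQuotient I := Quotient.mk (idealSetoid I) a

variable {I}

theorem mk_eq_mk {a b : A} : mk I a = mk I b ↔ symmDiff a b ∈ I :=
  Quotient.eq (r := idealSetoid I)

theorem ind {p : BoolQuotient I → Prop} (h : ∀ a, p (mk I a)) (x : BoolQuotient I) : p x :=
  Quotient.ind h x

/-- The order of the quotient: `[a] ≤ [b]` if `a \ b` belongs to `I`. -/
instance : PartialOrder (BoolQuotient I) where
  le := Quotient.lift₂ (fun a b => a \ b ∈ I) (by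
    intro a b c d h k
    replace h := (symmDiff_mem_iff I).1 h
    replace k := (symmDiff_mem_iff I).1 k
    refine propext ⟨fun w => ?_, fun w => ?_⟩
    · exact sdiff_mem_trans I (sdiff_mem_trans I h.2 w) k.1
    · exact sdiff_mem_trans I (sdiff_mem_trans I h.1 w) k.2)
  le_refl := ind fun a => by
    change a \ a ∈ I
    simp
  le_trans := ind fun a => ind fun b => ind fun c h k => sdiff_mem_trans I h k
  le_antisymm := ind fun a => ind fun b h k => mk_eq_mk.2 ((symmDiff_mem_iff I).2 ⟨h, k⟩)

theorem mk_le_mk {a b : A} : mk I a ≤ mk I b ↔ a \ b ∈ I := Iff.rfl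

theorem mk_mono {a b : A} (h : a ≤ b) : mk I a ≤ mk I b := by
  rw [mk_le_mk, sdiff_eq_bot_iff.2 h]
  exact I.bot_mem

/-- The Boolean operations of the quotient are those of representatives. -/
instance : BooleanAlgebra (BoolQuotient I) where
  sup := Quotient.map₂ (fun a b => a ⊔ b) (by
    intro a b h c d k
    replace h := (symmDiff_mem_iff I).1 h
    replace k := (symmDiff_mem_iff I).1 k
    refine (symmDiff_mem_iff I).2 ⟨?_, ?_⟩
    · exact I.lower (sup_sdiff_sup_le a b c d) (Order.Ideal.sup_mem h.1 k.1)
    · exact I.lower (sup_sdiff_sup_le b a d c) (Order.Ideal.sup_mem h.2 k.2))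
  inf := Quotient.map₂ (fun a b => a ⊓ b) (by
    intro a b h c d k
    replace h := (symmDiff_mem_iff I).1 h
    replace k := (symmDiff_mem_iff I).1 k
    refine (symmDiff_mem_iff I).2 ⟨?_, ?_⟩
    · exact I.lower (inf_sdiff_inf_le a b c d) (Order.Ideal.sup_mem h.1 k.1)
    · exact I.lower (inf_sdiff_inf_le b a d c) (Order.Ideal.sup_mem h.2 k.2))
  le_sup_left := ind fun a => ind fun b => mk_mono le_sup_left
  le_sup_right := ind fun a => ind fun b => mk_mono le_sup_right
  sup_le := ind fun a => ind fun b => ind fun c h k => by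
    change (a ⊔ b) \ c ∈ I
    rw [sup_sdiff]
    exact Order.Ideal.sup_mem h k
  inf_le_left := ind fun a => ind fun b => mk_mono inf_le_left
  inf_le_right := ind fun a => ind fun b => mk_mono inf_le_right
  le_inf := ind fun a => ind fun b => ind fun c h k => by
    change a \ (b ⊓ c) ∈ I
    rw [sdiff_inf]
    exact Order.Ideal.sup_mem h k
  le_sup_inf := ind fun a => ind fun b => ind fun c => mk_mono le_sup_inf
  compl := Quotient.map (fun a => aᶜ) (by
    intro a b h
    change symmDiff aᶜ bᶜ ∈ I
    rwa [compl_symmDiff_compl])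
  top := mk I ⊤
  bot := mk I ⊥
  le_top := ind fun a => mk_mono le_top
  bot_le := ind fun a => mk_mono bot_le
  inf_compl_le_bot := ind fun a => mk_mono (le_of_eq (inf_compl_self a))
  top_le_sup_compl := ind fun a => mk_mono (le_of_eq sup_compl_eq_top.symm)

end BoolQuotient

end Quotient

/-! ### Measurable sets and measurable functions -/

section Measurable

variable {M : Type*} [MeasurableSpace M]

/-- The `σ`-algebra of sets, as a Boolean algebra. -/
abbrev MSet (M : Type*) [MeasurableSpace M] : Type _ := Subtype (MeasurableSet : Set M → Prop)

/-- A `σ`-ideal in the `σ`-algebra of measurable subsets of `M`. -/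
structure SigmaIdeal (M : Type*) [MeasurableSpace M] extends Order.Ideal (MSet M) where
  iUnion_mem' : ∀ s : ℕ → MSet M, (∀ n, s n ∈ toIdeal) →
    (⟨⋃ n, (s n : Set M), MeasurableSet.iUnion fun n => (s n).2⟩ : MSet M) ∈ toIdeal

/-- The abstract `σ`-algebra of measurable sets modulo `I`. -/
abbrev QuotAlg (I : SigmaIdeal M) : Type _ := BoolQuotient I.toIdeal

/-- The set of all quasipoints of the `σ`-algebra of measurable sets that contain the dual
ideal of all complements of members of `I`. -/
def quasipointsOver (I : SigmaIdeal M) : Set (StoneSpectrum (MSet M)) :=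
  {B | ∀ a ∈ I.toIdeal, aᶜ ∈ B}

section Functions

variable (𝕜 : Type*) [RCLike 𝕜] (M)

/-- The algebra of all bounded measurable functions `M → 𝕜`, inside the algebra
`lp (fun _ : M => 𝕜) ∞` of all bounded functions with the supremum norm. -/
def BddMeas : StarSubalgebra 𝕜 (lp (fun _ : M => 𝕜) ∞) where
  carrier := {φ | Measurable fun x => φ x}
  mul_mem' ha hb := Measurable.mul ha hb
  add_mem' ha hb := Measurable.add ha hb
  algebraMap_mem' r := measurable_const (a := r)
  star_mem' ha := (RCLike.continuous_conj (K := 𝕜)).measurable.comp ha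

variable {M}

noncomputable instance : CommRing (BddMeas M 𝕜) := inferInstance

noncomputable instance : Ring (BddMeas M 𝕜) := inferInstance

/-- The ideal of all bounded measurable functions that vanish outside some member of `I`. -/
def vanishIdeal (I : SigmaIdeal M) : Ideal (BddMeas M 𝕜) where
  carrier := {φ | ∃ a ∈ I.toIdeal, ∀ x ∉ (a : Set M), φ.1 x = 0}
  zero_mem' := ⟨⊥, I.bot_mem, fun x _ => rfl⟩
  add_mem' := by
    rintro φ ψ ⟨a, ha, h⟩ ⟨b, hb, k⟩
    refine ⟨a ⊔ b, Order.Ideal.sup_mem ha hb, fun x hx => ?_⟩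
    have hx' : x ∉ (a : Set M) ∪ (b : Set M) := hx
    rw [Set.mem_union, not_or] at hx'
    change φ.1 x + ψ.1 x = 0
    rw [h x hx'.1, k x hx'.2, add_zero]
  smul_mem' := by
    rintro ψ φ ⟨a, ha, h⟩
    refine ⟨a, ha, fun x hx => ?_⟩
    change ψ.1 x * φ.1 x = 0
    rw [h x hx, mul_zero]

/-- Bounded measurable functions modulo the functions that vanish outside a member of `I`. -/
abbrev MeasQuot (I : SigmaIdeal M) : Type _ := BddMeas M 𝕜 ⧸ vanishIdeal 𝕜 I

instance isClosed_bddMeas : IsClosed (BddMeas M 𝕜 : Set (lp (fun _ : M => 𝕜) ∞)) := by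
  refine IsSeqClosed.isClosed fun u φ hu h => ?_
  refine measurable_of_tendsto_metrizable (f := fun n x => u n x) hu ?_
  rw [tendsto_pi_nhds]
  exact fun x => ((lp.lipschitzWith_one_eval (E := fun _ : M => 𝕜) ∞ x).continuous.tendsto φ).comp h

instance isClosed_vanishIdeal (I : SigmaIdeal M) :
    IsClosed (vanishIdeal 𝕜 I : Set (BddMeas M 𝕜)) := by
  refine IsSeqClosed.isClosed fun u φ hu h => ?_
  choose s hs hv using hu
  refine ⟨_, I.iUnion_mem' s hs, fun x hx => ?_⟩
  have hx' : ∀ n, x ∉ (s n : Set M) := fun n hn => hx (Set.mem_iUnion.2 ⟨n, hn⟩)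
  have h1 : Filter.Tendsto (fun n => (u n).1 x) Filter.atTop (nhds (φ.1 x)) :=
    (((lp.lipschitzWith_one_eval (E := fun _ : M => 𝕜) ∞ x).continuous.comp
      continuous_subtype_val).tendsto φ).comp h
  have h2 : (fun n => (u n).1 x) = fun _ => 0 := funext fun n => hv n x (hx' n)
  rw [h2] at h1
  exact tendsto_nhds_unique h1 tendsto_const_nhds

end Functions

noncomputable instance : CommCStarAlgebra (BddMeas M ℂ) := inferInstance

section CStar

variable (I : SigmaIdeal M)

theorem star_mem_vanishIdeal {φ : BddMeas M ℂ} (h : φ ∈ vanishIdeal ℂ I) :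
    star φ ∈ vanishIdeal ℂ I := by
  obtain ⟨a, ha, h⟩ := h
  refine ⟨a, ha, fun x hx => ?_⟩
  change star (φ.1 x) = 0
  rw [h x hx, star_zero]

/-- The involution of the quotient algebra is that of representatives. -/
noncomputable instance : StarRing (MeasQuot ℂ I) where
  star := Quotient.map' star (by
    intro φ ψ h
    rw [Submodule.quotientRel_def] at h ⊢
    have h' := star_mem_vanishIdeal I h
    rwa [star_sub] at h')
  star_involutive := by
    rintro ⟨φ⟩
    exact congrArg (Ideal.Quotient.mk (vanishIdeal ℂ I)) (star_star φ)
  star_mul := by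
    rintro ⟨φ⟩ ⟨ψ⟩
    exact congrArg (Ideal.Quotient.mk (vanishIdeal ℂ I)) (star_mul φ ψ)
  star_add := by
    rintro ⟨φ⟩ ⟨ψ⟩
    exact congrArg (Ideal.Quotient.mk (vanishIdeal ℂ I)) (star_add φ ψ)

theorem norm_mul_self_le_of_lt (x : MeasQuot ℂ I) {c : ℝ} (hc : ‖star x * x‖ < c) :
    ‖x‖ * ‖x‖ ≤ c := by
  obtain ⟨φ, rfl⟩ := Ideal.Quotient.mk_surjective x
  obtain ⟨ψ, hψ, hn⟩ := Ideal.Quotient.norm_mk_lt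
    (star (Ideal.Quotient.mk (vanishIdeal ℂ I) φ) * Ideal.Quotient.mk (vanishIdeal ℂ I) φ)
    (sub_pos.2 hc)
  rw [add_sub_cancel] at hn
  have hψ' : ψ - star φ * φ ∈ vanishIdeal ℂ I := (Ideal.Quotient.eq).1 hψ
  obtain ⟨a, ha, hv⟩ := hψ'
  have hc0 : 0 ≤ c := (norm_nonneg ψ).trans hn.le
  have hmem : Memℓp (fun y => Set.indicator (a : Set M)ᶜ (fun x => φ.1 x) y) ∞ :=
    memℓp_infty ⟨‖φ.1‖, by
      rintro _ ⟨y, rfl⟩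
      exact (norm_indicator_le_norm_self _ _).trans (lp.norm_apply_le_norm ENNReal.top_ne_zero φ.1 y)⟩
  let χ : BddMeas M ℂ := ⟨⟨_, hmem⟩, Measurable.indicator φ.2 a.2.compl⟩
  have hχ : ∀ y, χ.1 y = Set.indicator (a : Set M)ᶜ (fun x => φ.1 x) y := fun y => rfl
  have hχφ : Ideal.Quotient.mk (vanishIdeal ℂ I) φ = Ideal.Quotient.mk (vanishIdeal ℂ I) χ := by
    refine (Ideal.Quotient.eq).2 ⟨a, ha, fun y hy => ?_⟩
    change φ.1 y - χ.1 y = 0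
    rw [hχ, Set.indicator_of_mem (show y ∈ (a : Set M)ᶜ from hy), sub_self]
  have hle : ‖χ‖ ≤ Real.sqrt c := by
    refine lp.norm_le_of_forall_le (f := χ.1) (Real.sqrt_nonneg c) fun y => ?_
    refine Real.le_sqrt_of_sq_le ?_
    rw [hχ]
    by_cases hy : y ∈ (a : Set M)
    · rw [Set.indicator_of_notMem (Set.notMem_compl_iff.2 hy)]
      simpa using hc0
    · rw [Set.indicator_of_mem (show y ∈ (a : Set M)ᶜ from hy)]
      have h1 : ψ.1 y - star (φ.1 y) * φ.1 y = 0 := hv y hy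
      have h2 : ‖ψ.1 y‖ ≤ ‖ψ‖ := lp.norm_apply_le_norm ENNReal.top_ne_zero ψ.1 y
      rw [sub_eq_zero] at h1
      rw [h1, CStarRing.norm_star_mul_self] at h2
      rw [sq]
      exact h2.trans hn.le
  rw [hχφ]
  have h3 := (Ideal.Quotient.norm_mk_le (vanishIdeal ℂ I) χ).trans hle
  exact (mul_le_mul h3 h3 (norm_nonneg (Ideal.Quotient.mk (vanishIdeal ℂ I) χ))
    (Real.sqrt_nonneg c)).trans_eq (Real.mul_self_sqrt hc0)

/-- The quotient, with the quotient norm and the induced involution, is a `C⋆`-algebra. -/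
noncomputable instance : CommCStarAlgebra (MeasQuot ℂ I) where
  norm_mul_self_le x := le_of_forall_gt_imp_ge_of_dense fun _ hc => norm_mul_self_le_of_lt I x hc
  star_smul := by
    rintro r ⟨φ⟩
    exact congrArg (Ideal.Quotient.mk (vanishIdeal ℂ I)) (star_smul r φ)
  complete := CompleteSpace.complete

end CStar

section RealPart

/-- A bounded measurable real function, regarded as a complex function. -/
noncomputable def ofRealMeas (M : Type*) [MeasurableSpace M] : BddMeas M ℝ →+* BddMeas M ℂ where
  toFun φ := ⟨⟨fun x => ((φ.1 x : ℝ) : ℂ), memℓp_infty (by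
      obtain ⟨C, hC⟩ := (lp.memℓp φ.1).bddAbove
      refine ⟨C, ?_⟩
      rintro _ ⟨x, rfl⟩
      simpa using hC ⟨x, rfl⟩)⟩, Complex.measurable_ofReal.comp φ.2⟩
  map_one' := Subtype.ext (Subtype.ext (funext fun _ => Complex.ofReal_one))
  map_mul' φ ψ := Subtype.ext (Subtype.ext (funext fun x => Complex.ofReal_mul (φ.1 x) (ψ.1 x)))
  map_zero' := Subtype.ext (Subtype.ext (funext fun _ => Complex.ofReal_zero))
  map_add' φ ψ := Subtype.ext (Subtype.ext (funext fun x => Complex.ofReal_add (φ.1 x) (ψ.1 x)))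

variable (I : SigmaIdeal M)

/-- The map `[φ] ↦ [φ]` from classes of real functions to classes of complex functions. -/
noncomputable def ofRealQuot : MeasQuot ℝ I →+* MeasQuot ℂ I :=
  Ideal.quotientMap (vanishIdeal ℂ I) (ofRealMeas M) (by
    rintro φ ⟨a, ha, h⟩
    refine ⟨a, ha, fun x hx => ?_⟩
    change ((φ.1 x : ℝ) : ℂ) = 0
    rw [h x hx, Complex.ofReal_zero])

/-- The spectral family of a bounded measurable function: the preimages of the half lines
`]-∞, t]`. -/
def specFamily (φ : BddMeas M ℝ) (t : ℝ) : MSet M := ⟨{x | φ.1 x ≤ t}, φ.2 measurableSet_Iic⟩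

/-- The spectral family in the quotient `σ`-algebra that belongs to a class of functions: at `t`
it is the class of `specFamily φ t` modulo `I`, for any representative `φ`. -/
noncomputable def specFamilyQuot (x : MeasQuot ℝ I) (t : ℝ) : QuotAlg I :=
  Quotient.liftOn' x (fun φ => BoolQuotient.mk I.toIdeal (specFamily φ t)) (by
    intro φ ψ h
    rw [Submodule.quotientRel_def] at h
    obtain ⟨a, ha, h⟩ := h
    refine BoolQuotient.mk_eq_mk.2 (I.lower ?_ ha)
    intro x hx
    by_contra hxa
    have hxy : φ.1 x = ψ.1 x := sub_eq_zero.1 (h x hxa)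
    rcases hx with ⟨h1, h2⟩ | ⟨h1, h2⟩
    · exact h2 (show ψ.1 x ≤ t from hxy ▸ h1)
    · exact h2 (show φ.1 x ≤ t from hxy ▸ h1))

end RealPart

end Measurable

end ClassicalObservables

open ClassicalObservables

namespace ClassicalObservables

/-! ### Quasipoints of Boolean algebras -/

namespace StoneSpectrum

section Lattice

variable {L : Type*} [Lattice L] [BoundedOrder L] (B : StoneSpectrum L)

/-! Quasipoints of a Boolean algebra `L` are its ultrafilters. Let `p` represent `L` faithfully by
idempotents of a commutative C⋆-algebra `A`. A character takes only the values 0 and 1 on them, and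
the elements sent to 1 form a quasipoint. The resulting map from characters to quasipoints is
continuous, and it is onto by compactness of the Gelfand spectrum (`surjective_quasipoint`).

Suppose a selfadjoint `x` has a family `E` in `L` such that every character `τ` satisfies `τ x ≤ t`
where `p (E t)` is sent to 1 and `t ≤ τ x` where it is sent to 0. Then `τ x` is the infimum of the
`t` with `E t` in the quasipoint of `τ`, i.e. the associated function of `E` there
(`apply_eq_assocFun`). If every selfadjoint element has such a family, the quasipoint determines
`τ`. So the map is a continuous bijection from a compact space onto a Hausdorff space, and its
inverse turns the Gelfand transform into the associated function.

This applies to characteristic functions and to their classes modulo the ideal. The inequalities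
follow from algebraic identities with squares, which pass to the quotient algebra. Countable
additivity of the ideal gives right continuity of the spectral families in the quotient. The
embedding of Stone spectra is the preimage under the quotient map; its image consists of the
quasipoints that do not distinguish equivalent sets. -/

theorem mem_of_le {a b : L} (h : a ≤ b) (ha : a ∈ B) : b ∈ B :=
  Order.PFilter.mem_of_le (F := B.1) h ha

theorem inf_mem {a b : L} (ha : a ∈ B) (hb : b ∈ B) : a ⊓ b ∈ B :=
  Order.PFilter.inf_mem (F := B.1) ha hb

theorem top_mem : (⊤ : L) ∈ B := Order.PFilter.top_mem (F := B.1)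

theorem bot_notMem : (⊥ : L) ∉ B := B.2.prop

theorem isOpen_setOf_mem (a : L) : IsOpen {B : StoneSpectrum L | a ∈ B} :=
  TopologicalSpace.isOpen_generateFrom_of_mem ⟨a, rfl⟩

variable {B}

@[ext] theorem ext {C : StoneSpectrum L} (h : ∀ a, a ∈ B ↔ a ∈ C) : B = C :=
  Subtype.ext (Order.PFilter.ext _ _ (Set.ext h))

end Lattice

variable {L : Type*} [BooleanAlgebra L]

/-- Otherwise the filter generated by `B` and `a` is still proper, because `b ⊓ a = ⊥` with `b ∈ B`
would force `aᶜ ∈ B`; maximality then puts `a` into `B`. -/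
theorem mem_or_compl_mem (B : StoneSpectrum L) (a : L) : a ∈ B ∨ aᶜ ∈ B := by
  by_contra! h
  obtain ⟨ha, hc⟩ := h
  have hF : Order.IsPFilter {x : L | ∃ b ∈ B, b ⊓ a ≤ x} := by
    refine Order.IsPFilter.of_def ⟨⊤, ⊤, B.top_mem, le_top⟩ ?_ ?_
    · rintro x ⟨b, hb, hx⟩ y ⟨c, hc, hy⟩
      exact ⟨x ⊓ y, ⟨b ⊓ c, B.inf_mem hb hc,
        le_inf ((inf_le_inf_right a inf_le_left).trans hx)
          ((inf_le_inf_right a inf_le_right).trans hy)⟩, inf_le_left, inf_le_right⟩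
    · rintro x y hxy ⟨b, hb, hx⟩
      exact ⟨b, hb, hx.trans hxy⟩
  have hbot : (⊥ : L) ∉ hF.toPFilter := by
    rintro ⟨b, hb, h⟩
    exact hc (B.mem_of_le (le_compl_iff_disjoint_right.2 (disjoint_iff_inf_le.2 h)) hb)
  have hle : B.1 ≤ hF.toPFilter := fun b hb => ⟨b, hb, inf_le_left⟩
  exact ha (B.2.le_of_ge hbot hle ⟨⊤, B.top_mem, inf_le_right⟩)

theorem compl_mem_iff (B : StoneSpectrum L) (a : L) : aᶜ ∈ B ↔ a ∉ B := by
  refine ⟨fun h ha => B.bot_notMem ?_, (B.mem_or_compl_mem a).resolve_left⟩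
  rw [← inf_compl_self a]
  exact B.inf_mem ha h

/-- A quasipoint of a Boolean algebra from a proper ultrafilter. -/
def ofUltrafilter (s : Set L) (htop : ⊤ ∈ s) (hle : ∀ {a b : L}, a ≤ b → a ∈ s → b ∈ s)
    (hinf : ∀ {a b : L}, a ∈ s → b ∈ s → a ⊓ b ∈ s) (hbot : ⊥ ∉ s)
    (hcompl : ∀ a, a ∈ s ∨ aᶜ ∈ s) : StoneSpectrum L :=
  ⟨(Order.IsPFilter.of_def (F := s) ⟨⊤, htop⟩
      (fun a ha b hb => ⟨a ⊓ b, hinf ha hb, inf_le_left, inf_le_right⟩) hle).toPFilter, by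
    refine ⟨hbot, fun G hG hsG a ha => (hcompl a).resolve_right fun hc => hG ?_⟩
    rw [← inf_compl_self a]
    exact Order.PFilter.inf_mem ha (hsG hc)⟩

theorem eq_of_forall_mem {B C : StoneSpectrum L} (h : ∀ a ∈ B, a ∈ C) : B = C := by
  ext a
  refine ⟨h a, fun ha => (B.mem_or_compl_mem a).resolve_right fun hc => ?_⟩
  exact (C.compl_mem_iff a).1 (h _ hc) ha

/-- Distinct quasipoints are separated by some `a` and its complement. -/
instance : T2Space (StoneSpectrum L) := by
  refine ⟨fun B C hBC => ?_⟩
  obtain ⟨a, haB, haC⟩ : ∃ a ∈ B, a ∉ C := by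
    by_contra! h
    exact hBC (eq_of_forall_mem h)
  refine ⟨_, _, isOpen_setOf_mem a, isOpen_setOf_mem aᶜ, haB, (C.compl_mem_iff a).2 haC, ?_⟩
  rw [Set.disjoint_left]
  exact fun D h k => (D.compl_mem_iff a).1 k h

end StoneSpectrum

/-! ### Characters and quasipoints -/

open WeakDual

section Projections

variable {L A : Type*} [BooleanAlgebra L] [CommCStarAlgebra A]

/-- A faithful representation of a Boolean algebra by projections of a commutative algebra. -/
structure IsFaithfulRep (p : L → A) : Prop where
  map_top : p ⊤ = 1
  map_inf : ∀ a b, p (a ⊓ b) = p a * p b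
  map_compl : ∀ a, p aᶜ = 1 - p a
  eq_bot : ∀ a, p a = 0 → a = ⊥

/-- `E` is a family of spectral projections of `x`, as seen by the characters. -/
def IsSpectralFor (p : L → A) (E : ℝ → L) (x : A) : Prop :=
  ∀ (τ : characterSpace ℂ A) (t : ℝ), ∃ r : ℝ, τ x = r ∧
    (τ (p (E t)) = 1 → r ≤ t) ∧ (τ (p (E t)) = 0 → t ≤ r)

theorem exists_ofReal_eq_of_isSelfAdjoint {x : A} (hx : IsSelfAdjoint x)
    (τ : characterSpace ℂ A) : ∃ r : ℝ, τ x = r := by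
  have h : star (τ x) = τ x := by rw [← map_star, hx.star_eq]
  exact ⟨(τ x).re, (Complex.conj_eq_iff_re.1 h).symm⟩

-- Characters send squares of selfadjoint elements to nonnegative reals. Expressing the order
-- relations by such squares makes them purely algebraic, hence stable under homomorphisms.
omit [BooleanAlgebra L] in
theorem isSpectralFor_of_mul_self {p : L → A} {E : ℝ → L} {x : A} (hx : IsSelfAdjoint x)
    (h : ∀ t : ℝ, ∃ g : A, IsSelfAdjoint g ∧ p (E t) * (algebraMap ℂ A t - x) = g * g)
    (h' : ∀ t : ℝ, ∃ g : A, IsSelfAdjoint g ∧ (1 - p (E t)) * (x - algebraMap ℂ A t) = g * g) :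
    IsSpectralFor p E x := by
  intro τ t
  have hτ : τ (algebraMap ℂ A t) = t := AlgHomClass.commutes τ (t : ℂ)
  obtain ⟨r, hr⟩ := exists_ofReal_eq_of_isSelfAdjoint hx τ
  refine ⟨r, hr, fun h1 => ?_, fun h0 => ?_⟩
  · obtain ⟨g, hg, hgx⟩ := h t
    obtain ⟨s, hs⟩ := exists_ofReal_eq_of_isSelfAdjoint hg τ
    have := congrArg τ hgx
    rw [map_mul, map_mul, map_sub, hτ, hr, h1, hs, one_mul] at this
    have h2 : t - r = s * s := by exact_mod_cast this
    nlinarith [mul_self_nonneg s]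
  · obtain ⟨g, hg, hgx⟩ := h' t
    obtain ⟨s, hs⟩ := exists_ofReal_eq_of_isSelfAdjoint hg τ
    have := congrArg τ hgx
    rw [map_mul, map_mul, map_sub, map_sub, hτ, hr, h0, hs, map_one, sub_zero, one_mul] at this
    have h2 : r - t = s * s := by exact_mod_cast this
    nlinarith [mul_self_nonneg s]

namespace IsFaithfulRep

variable {p : L → A} (hp : IsFaithfulRep p) (τ : characterSpace ℂ A)
include hp

theorem map_bot : p ⊥ = 0 := by rw [← compl_top, hp.map_compl, hp.map_top, sub_self]

theorem apply_eq_zero_or_one (a : L) : τ (p a) = 0 ∨ τ (p a) = 1 := by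
  have h : τ (p a) * τ (p a) = τ (p a) := by rw [← map_mul, ← hp.map_inf, inf_idem]
  rcases eq_or_ne (τ (p a)) 0 with h0 | h0
  · exact Or.inl h0
  · exact Or.inr (mul_left_cancel₀ h0 (by rw [h, mul_one]))

theorem apply_compl (a : L) : τ (p aᶜ) = 1 - τ (p a) := by
  rw [hp.map_compl, map_sub, map_one]

theorem apply_eq_one_of_le {a b : L} (hab : a ≤ b) (h : τ (p a) = 1) : τ (p b) = 1 := by
  have h1 : τ (p a) * τ (p b) = τ (p a) := by rw [← map_mul, ← hp.map_inf, inf_eq_left.2 hab]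
  rwa [h, one_mul] at h1

/-- The quasipoint of all elements whose projections are mapped to `1` by the character `τ`. -/
noncomputable def quasipoint : StoneSpectrum L :=
  StoneSpectrum.ofUltrafilter {a | τ (p a) = 1} (by simp [hp.map_top])
    (fun hab h => hp.apply_eq_one_of_le τ hab h)
    (fun {a b} (ha : τ (p a) = 1) (hb : τ (p b) = 1) => by
      simp [hp.map_inf, ha, hb])
    (by simp [hp.map_bot])
    (fun a => (hp.apply_eq_zero_or_one τ a).symm.imp id fun h => by
      simp [hp.apply_compl, h])

theorem continuous_quasipoint : Continuous hp.quasipoint := by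
  refine continuous_generateFrom_iff.2 ?_
  rintro _ ⟨a, rfl⟩
  -- Since only the values 0 and 1 occur, the closed condition `τ (p a) = 1` is the open condition
  -- `τ (p a) ≠ 0`.
  have h : hp.quasipoint ⁻¹' {B | a ∈ B} = (fun τ : characterSpace ℂ A => τ (p a)) ⁻¹' {0}ᶜ := by
    ext τ
    change τ (p a) = 1 ↔ τ (p a) ≠ 0
    rcases hp.apply_eq_zero_or_one τ a with h | h <;> simp [h]
  rw [h]
  exact isOpen_compl_singleton.preimage ((gelfandTransform ℂ A (p a)).continuous)

/-- The Gelfand transform is injective, so a nonzero `p a` cannot be killed by every character. -/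
theorem exists_apply_eq_one {a : L} (ha : a ≠ ⊥) : ∃ τ : characterSpace ℂ A, τ (p a) = 1 := by
  by_contra! h
  refine ha (hp.eq_bot a ((gelfandTransform_isometry A).injective ?_))
  rw [map_zero]
  ext τ
  exact (hp.apply_eq_zero_or_one τ a).resolve_right (h τ)

/-- The sets of characters equal to 1 on `p a`, for `a ∈ B`, are compact, directed and nonempty. A
common point has a quasipoint containing `B`, hence equal to it. -/
theorem surjective_quasipoint : Function.Surjective hp.quasipoint := by
  intro B
  let t : {a // a ∈ B} → Set (characterSpace ℂ A) := fun a => {τ | τ (p a) = 1}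
  have hclosed : ∀ a, IsClosed (t a) := fun a =>
    isClosed_singleton.preimage ((gelfandTransform ℂ A (p a)).continuous)
  have : Nonempty {a // a ∈ B} := ⟨⟨⊤, B.top_mem⟩⟩
  obtain ⟨τ, hτ⟩ := IsCompact.nonempty_iInter_of_directed_nonempty_isCompact_isClosed t
    (fun a b => ⟨⟨a ⊓ b, B.inf_mem a.2 b.2⟩,
      fun τ h => hp.apply_eq_one_of_le τ inf_le_left h,
      fun τ h => hp.apply_eq_one_of_le τ inf_le_right h⟩)
    (fun a => hp.exists_apply_eq_one fun h => B.bot_notMem (h ▸ a.2))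
    (fun a => (hclosed a).isCompact) hclosed
  rw [Set.mem_iInter] at hτ
  exact ⟨τ, (StoneSpectrum.eq_of_forall_mem fun a ha => hτ ⟨a, ha⟩).symm⟩

/-- The value `τ (p (E t))` is 0 for `t < τ x` and 1 for `t > τ x`; what happens at `t = τ x` does
not affect the infimum. -/
theorem apply_eq_assocFun {E : ℝ → L} {x : A} (h : IsSpectralFor p E x) :
    τ x = (assocFun E (hp.quasipoint τ) : ℂ) := by
  -- The choice 0 is arbitrary: the real number given for each `t` is always `τ x`.
  obtain ⟨r, hr, -⟩ := h τ 0
  have key : ∀ t, (τ (p (E t)) = 1 → r ≤ t) ∧ (τ (p (E t)) = 0 → t ≤ r) := by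
    intro t
    obtain ⟨r', hr', h'⟩ := h τ t
    rwa [Complex.ofReal_injective (hr.symm.trans hr')]
  rw [hr]
  congr 1
  -- The point `r + 1` shows that the set is nonempty, which the real infimum requires.
  refine (IsGLB.csInf_eq ⟨fun t ht => (key t).1 ht, fun b hb => ?_⟩ ⟨r + 1, ?_⟩).symm
  · refine le_of_forall_gt_imp_ge_of_dense fun t ht => hb ?_
    exact (hp.apply_eq_zero_or_one τ (E t)).resolve_left fun h0 => ht.not_ge ((key t).2 h0)
  · refine (hp.apply_eq_zero_or_one τ (E (r + 1))).resolve_left fun h0 => ?_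
    linarith [(key (r + 1)).2 h0]

/-- The quasipoint fixes the character on selfadjoint elements, and these span the algebra over `ℂ`.
-/
theorem injective_quasipoint (h : ∀ x : A, IsSelfAdjoint x → ∃ E : ℝ → L, IsSpectralFor p E x) :
    Function.Injective hp.quasipoint := by
  intro τ σ hτσ
  have hsa : ∀ x : A, IsSelfAdjoint x → τ x = σ x := by
    intro x hx
    obtain ⟨E, hE⟩ := h x hx
    rw [hp.apply_eq_assocFun τ hE, hp.apply_eq_assocFun σ hE, hτσ]
  refine CharacterSpace.ext fun x => ?_
  rw [← realPart_add_I_smul_imaginaryPart x, map_add, map_add, map_smul, map_smul,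
    hsa _ (realPart x).2, hsa _ (imaginaryPart x).2]

/-- If every selfadjoint element has spectral projections in a Boolean algebra, then the Gelfand
spectrum is homeomorphic to the Stone spectrum. -/
noncomputable def homeomorph
    (h : ∀ x : A, IsSelfAdjoint x → ∃ E : ℝ → L, IsSpectralFor p E x) :
    StoneSpectrum L ≃ₜ characterSpace ℂ A :=
  (Continuous.homeoOfEquivCompactToT2
    (f := Equiv.ofBijective hp.quasipoint ⟨hp.injective_quasipoint h, hp.surjective_quasipoint⟩)
    hp.continuous_quasipoint).symm

theorem homeomorph_apply
    (h : ∀ x : A, IsSelfAdjoint x → ∃ E : ℝ → L, IsSpectralFor p E x)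
    {E : ℝ → L} {x : A} (hE : IsSpectralFor p E x) (B : StoneSpectrum L) :
    gelfandTransform ℂ A x (hp.homeomorph h B) = (assocFun E B : ℂ) := by
  have h1 : hp.quasipoint (hp.homeomorph h B) = B := (hp.homeomorph h).symm_apply_apply B
  conv_rhs => rw [← h1]
  exact hp.apply_eq_assocFun _ hE

end IsFaithfulRep

end Projections

/-! ### Bounded measurable functions -/

section Functions

variable {M : Type*} [MeasurableSpace M]

namespace BddMeas

variable {𝕜 : Type*} [RCLike 𝕜]

theorem ext_apply {φ ψ : BddMeas M 𝕜} (h : ∀ x, φ.1 x = ψ.1 x) : φ = ψ :=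
  Subtype.ext (Subtype.ext (funext h))

theorem norm_apply_le (φ : BddMeas M 𝕜) (x : M) : ‖φ.1 x‖ ≤ ‖φ‖ :=
  lp.norm_apply_le_norm ENNReal.top_ne_zero φ.1 x

/-- A bounded measurable function as an element of the algebra of these functions. -/
def ofFun (f : M → 𝕜) (hf : Measurable f) (hb : ∃ C : ℝ, ∀ x, ‖f x‖ ≤ C) : BddMeas M 𝕜 :=
  ⟨⟨f, memℓp_infty (by
    obtain ⟨C, hC⟩ := hb
    refine ⟨C, ?_⟩
    rintro _ ⟨x, rfl⟩
    exact hC x)⟩, hf⟩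

/-- The characteristic function of a measurable set. -/
noncomputable def indicator (a : MSet M) : BddMeas M ℂ :=
  ofFun (Set.indicator (a : Set M) 1) (measurable_one.indicator a.2)
    ⟨1, fun x => (norm_indicator_le_norm_self _ _).trans (by simp)⟩

theorem indicator_apply (a : MSet M) (x : M) :
    (indicator a).1 x = Set.indicator (a : Set M) 1 x := rfl

theorem indicator_apply_of_mem {a : MSet M} {x : M} (h : x ∈ (a : Set M)) :
    (indicator a).1 x = 1 := Set.indicator_of_mem h 1

theorem indicator_apply_of_notMem {a : MSet M} {x : M} (h : x ∉ (a : Set M)) :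
    (indicator a).1 x = 0 := Set.indicator_of_notMem h 1

theorem indicator_top : indicator (⊤ : MSet M) = 1 :=
  ext_apply fun x => indicator_apply_of_mem (Set.mem_univ x)

theorem indicator_inf (a b : MSet M) : indicator (a ⊓ b) = indicator a * indicator b := by
  refine ext_apply fun x => ?_
  have h1 : (indicator a * indicator b).1 x = (indicator a).1 x * (indicator b).1 x := rfl
  have h2 : ((a ⊓ b : MSet M) : Set M) = (a : Set M) ∩ b := rfl
  rw [h1, indicator_apply, indicator_apply, indicator_apply, h2]
  by_cases ha : x ∈ (a : Set M) <;> by_cases hb : x ∈ (b : Set M) <;> simp [ha, hb]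

theorem indicator_compl (a : MSet M) : indicator aᶜ = 1 - indicator a := by
  refine ext_apply fun x => ?_
  have h1 : (1 - indicator a).1 x = 1 - (indicator a).1 x := rfl
  rw [h1, indicator_apply, indicator_apply, MeasurableSet.coe_compl]
  by_cases h : x ∈ (a : Set M) <;> simp [h]

theorem isFaithfulRep_indicator : IsFaithfulRep (indicator (M := M)) where
  map_top := indicator_top
  map_inf := indicator_inf
  map_compl := indicator_compl
  eq_bot a h := by
    refine Subtype.ext (Set.eq_empty_of_forall_notMem fun x hx => one_ne_zero (α := ℂ) ?_)
    rw [← indicator_apply_of_mem hx, h]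
    rfl

theorem isSelfAdjoint_ofRealMeas (φ : BddMeas M ℝ) : IsSelfAdjoint (ofRealMeas M φ) :=
  ext_apply fun x => Complex.conj_ofReal (φ.1 x)

/-- The square root of the positive part. -/
noncomputable def sqrtPos (φ : BddMeas M ℝ) : BddMeas M ℝ :=
  ofFun (fun x => √(φ.1 x)) φ.2.sqrt ⟨√‖φ‖, fun x => by
    rw [Real.norm_of_nonneg (Real.sqrt_nonneg _)]
    exact Real.sqrt_le_sqrt ((le_abs_self _).trans (norm_apply_le φ x))⟩

/-- `Real.sqrt` is 0 on negative numbers, so its square is the positive part. -/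
theorem sqrtPos_mul_self_apply (φ : BddMeas M ℝ) (x : M) :
    (ofRealMeas M (sqrtPos φ) * ofRealMeas M (sqrtPos φ)).1 x = ((max (φ.1 x) 0 : ℝ) : ℂ) := by
  change ((√(φ.1 x) : ℝ) : ℂ) * ((√(φ.1 x) : ℝ) : ℂ) = _
  rw [← Complex.ofReal_mul]
  congr 1
  rcases le_total 0 (φ.1 x) with h | h
  · rw [Real.mul_self_sqrt h, max_eq_left h]
  · rw [Real.sqrt_eq_zero_of_nonpos h, max_eq_right h, mul_zero]

theorem indicator_specFamily_mul (φ : BddMeas M ℝ) (t : ℝ) :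
    indicator (specFamily φ t) * (algebraMap ℂ (BddMeas M ℂ) t - ofRealMeas M φ) =
      ofRealMeas M (sqrtPos (algebraMap ℝ (BddMeas M ℝ) t - φ)) *
        ofRealMeas M (sqrtPos (algebraMap ℝ (BddMeas M ℝ) t - φ)) := by
  refine ext_apply fun x => ?_
  rw [sqrtPos_mul_self_apply]
  change (indicator (specFamily φ t)).1 x * ((t : ℂ) - (φ.1 x : ℝ)) =
    ((max (t - φ.1 x) 0 : ℝ) : ℂ)
  by_cases h : φ.1 x ≤ t
  · rw [indicator_apply_of_mem h, one_mul, max_eq_left (sub_nonneg.2 h), Complex.ofReal_sub]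
  · rw [indicator_apply_of_notMem h, zero_mul, max_eq_right (sub_nonpos.2 (not_le.1 h).le),
      Complex.ofReal_zero]

theorem one_sub_indicator_specFamily_mul (φ : BddMeas M ℝ) (t : ℝ) :
    (1 - indicator (specFamily φ t)) * (ofRealMeas M φ - algebraMap ℂ (BddMeas M ℂ) t) =
      ofRealMeas M (sqrtPos (φ - algebraMap ℝ (BddMeas M ℝ) t)) *
        ofRealMeas M (sqrtPos (φ - algebraMap ℝ (BddMeas M ℝ) t)) := by
  refine ext_apply fun x => ?_
  rw [sqrtPos_mul_self_apply]
  change (1 - (indicator (specFamily φ t)).1 x) * ((φ.1 x : ℝ) - (t : ℂ)) =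
    ((max (φ.1 x - t) 0 : ℝ) : ℂ)
  by_cases h : φ.1 x ≤ t
  · rw [indicator_apply_of_mem h, sub_self, zero_mul, max_eq_right (sub_nonpos.2 h),
      Complex.ofReal_zero]
  · rw [indicator_apply_of_notMem h, sub_zero, one_mul,
      max_eq_left (sub_nonneg.2 (not_le.1 h).le), Complex.ofReal_sub]

theorem isSpectralFor_specFamily (φ : BddMeas M ℝ) :
    IsSpectralFor indicator (specFamily φ) (ofRealMeas M φ) :=
  isSpectralFor_of_mul_self (isSelfAdjoint_ofRealMeas φ)
    (fun t => ⟨_, isSelfAdjoint_ofRealMeas _, indicator_specFamily_mul φ t⟩)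
    (fun t => ⟨_, isSelfAdjoint_ofRealMeas _, one_sub_indicator_specFamily_mul φ t⟩)

/-- The real part of a bounded measurable function. -/
noncomputable def re (φ : BddMeas M ℂ) : BddMeas M ℝ :=
  ofFun (fun x => (φ.1 x).re) (Complex.measurable_re.comp φ.2)
    ⟨‖φ‖, fun x => (Complex.abs_re_le_norm _).trans (norm_apply_le φ x)⟩

theorem exists_ofRealMeas_eq {φ : BddMeas M ℂ} (h : IsSelfAdjoint φ) :
    ∃ ψ, ofRealMeas M ψ = φ := by
  refine ⟨re φ, ext_apply fun x => Complex.conj_eq_iff_re.1 ?_⟩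
  exact congrArg (fun ψ : BddMeas M ℂ => ψ.1 x) h

end BddMeas

/-! ### The quotient algebra -/

variable (I : SigmaIdeal M)

/-- The class of the characteristic function of a measurable set. -/
noncomputable def indicatorQuot : QuotAlg I → MeasQuot ℂ I :=
  Quotient.lift (fun a => Ideal.Quotient.mk (vanishIdeal ℂ I) (BddMeas.indicator a)) (by
    intro a b h
    -- The exceptional set is the symmetric difference of `a` and `b`.
    refine Ideal.Quotient.eq.2 ⟨_, h, fun x hx => ?_⟩
    change (BddMeas.indicator a).1 x - (BddMeas.indicator b).1 x = 0
    change x ∉ symmDiff (a : Set M) (b : Set M) at hx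
    rw [Set.mem_symmDiff] at hx
    rw [BddMeas.indicator_apply, BddMeas.indicator_apply]
    by_cases ha : x ∈ (a : Set M) <;> by_cases hb : x ∈ (b : Set M) <;> simp_all)

theorem indicatorQuot_mk (a : MSet M) : indicatorQuot I (BoolQuotient.mk I.toIdeal a) =
    Ideal.Quotient.mk (vanishIdeal ℂ I) (BddMeas.indicator a) := rfl

theorem isFaithfulRep_indicatorQuot : IsFaithfulRep (indicatorQuot I) where
  map_top := congrArg (Ideal.Quotient.mk (vanishIdeal ℂ I)) BddMeas.indicator_top
  map_inf := BoolQuotient.ind fun a => BoolQuotient.ind fun b =>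
    congrArg (Ideal.Quotient.mk (vanishIdeal ℂ I)) (BddMeas.indicator_inf a b)
  map_compl := BoolQuotient.ind fun a =>
    congrArg (Ideal.Quotient.mk (vanishIdeal ℂ I)) (BddMeas.indicator_compl a)
  eq_bot := BoolQuotient.ind fun a h => by
    rw [indicatorQuot_mk, Ideal.Quotient.eq_zero_iff_mem] at h
    obtain ⟨b, hb, h⟩ := h
    refine BoolQuotient.mk_eq_mk.2 ?_
    rw [symmDiff_bot]
    -- A characteristic function vanishing outside `b` belongs to a subset of `b`.
    refine I.lower (fun x hx => ?_) hb
    by_contra hxb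
    have := h x hxb
    rw [BddMeas.indicator_apply_of_mem hx] at this
    exact one_ne_zero this

theorem ofRealQuot_mk (φ : BddMeas M ℝ) : ofRealQuot I (Ideal.Quotient.mk (vanishIdeal ℝ I) φ) =
    Ideal.Quotient.mk (vanishIdeal ℂ I) (ofRealMeas M φ) := rfl

theorem isSelfAdjoint_mk {φ : BddMeas M ℂ} (h : IsSelfAdjoint φ) :
    IsSelfAdjoint (Ideal.Quotient.mk (vanishIdeal ℂ I) φ) :=
  congrArg (Ideal.Quotient.mk (vanishIdeal ℂ I)) h

theorem isSelfAdjoint_ofRealQuot (x : MeasQuot ℝ I) : IsSelfAdjoint (ofRealQuot I x) := by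
  obtain ⟨φ, rfl⟩ := Ideal.Quotient.mk_surjective x
  exact isSelfAdjoint_mk I (BddMeas.isSelfAdjoint_ofRealMeas φ)

theorem injective_ofRealQuot : Function.Injective (ofRealQuot I) := by
  refine (injective_iff_map_eq_zero _).2 fun x hx => ?_
  obtain ⟨φ, rfl⟩ := Ideal.Quotient.mk_surjective x
  rw [ofRealQuot_mk, Ideal.Quotient.eq_zero_iff_mem] at hx
  obtain ⟨a, ha, h⟩ := hx
  exact Ideal.Quotient.eq_zero_iff_mem.2 ⟨a, ha, fun x hx => Complex.ofReal_injective (h x hx)⟩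

/-- A representative of a selfadjoint class is real outside a member of `I`, so its real part
represents the same class. -/
theorem exists_ofRealQuot_eq {x : MeasQuot ℂ I} (hx : IsSelfAdjoint x) :
    ∃ y, ofRealQuot I y = x := by
  obtain ⟨φ, rfl⟩ := Ideal.Quotient.mk_surjective x
  obtain ⟨a, ha, h⟩ := Ideal.Quotient.eq.1 (show Ideal.Quotient.mk (vanishIdeal ℂ I) (star φ) =
    Ideal.Quotient.mk (vanishIdeal ℂ I) φ from hx)
  refine ⟨Ideal.Quotient.mk (vanishIdeal ℝ I) (BddMeas.re φ), Ideal.Quotient.eq.2 ⟨a, ha, fun x hxa => ?_⟩⟩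
  have h1 : star (φ.1 x) - φ.1 x = 0 := h x hxa
  change ((φ.1 x).re : ℂ) - φ.1 x = 0
  exact sub_eq_zero.2 (Complex.conj_eq_iff_re.1 (sub_eq_zero.1 h1))

theorem range_ofRealQuot : Set.range (ofRealQuot I) = {a : MeasQuot ℂ I | IsSelfAdjoint a} := by
  ext a
  refine ⟨?_, exists_ofRealQuot_eq I⟩
  rintro ⟨x, rfl⟩
  exact isSelfAdjoint_ofRealQuot I x

theorem isSpectralFor_specFamilyQuot (x : MeasQuot ℝ I) :
    IsSpectralFor (indicatorQuot I) (specFamilyQuot I x) (ofRealQuot I x) := by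
  obtain ⟨φ, rfl⟩ := Ideal.Quotient.mk_surjective x
  exact isSpectralFor_of_mul_self (isSelfAdjoint_ofRealQuot I _)
    (fun t => ⟨_, isSelfAdjoint_mk I (BddMeas.isSelfAdjoint_ofRealMeas _),
      congrArg (Ideal.Quotient.mk (vanishIdeal ℂ I)) (BddMeas.indicator_specFamily_mul φ t)⟩)
    (fun t => ⟨_, isSelfAdjoint_mk I (BddMeas.isSelfAdjoint_ofRealMeas _),
      congrArg (Ideal.Quotient.mk (vanishIdeal ℂ I))
        (BddMeas.one_sub_indicator_specFamily_mul φ t)⟩)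

/-! ### Spectral families of measurable functions -/

section SpectralFamily

theorem isGLB_range_bot {L : Type*} [Lattice L] [BoundedOrder L] {E : ℝ → L} {t : ℝ}
    (h : E t = ⊥) : IsGLB (Set.range E) ⊥ :=
  ⟨fun _ _ => bot_le, fun _ hb => h ▸ hb ⟨t, rfl⟩⟩

theorem isLUB_range_top {L : Type*} [Lattice L] [BoundedOrder L] {E : ℝ → L} {t : ℝ}
    (h : E t = ⊤) : IsLUB (Set.range E) ⊤ :=
  ⟨fun _ _ => le_top, fun _ hb => h ▸ hb ⟨t, rfl⟩⟩

theorem isBoundedSpectralFamily_of_bounded {L : Type*} [Lattice L] [BoundedOrder L] {E : ℝ → L}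
    {a b : ℝ} (mono : Monotone E)
    (hinf : ∀ (t : ℝ) (c : L), (∀ s, t < s → c ≤ E s) → c ≤ E t)
    (ha : ∀ t < a, E t = ⊥) (hb : ∀ t, b ≤ t → E t = ⊤) : IsBoundedSpectralFamily E where
  mono := mono
  rightCont t := by
    refine ⟨?_, fun c hc => hinf t c fun s hs => hc ⟨s, hs, rfl⟩⟩
    rintro _ ⟨s, hs, rfl⟩
    exact mono (le_of_lt hs)
  inf_eq := isGLB_range_bot (ha (a - 1) (by linarith))
  sup_eq := isLUB_range_top (hb b le_rfl)
  bounded := ⟨a, b, ha, hb⟩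

variable (φ : BddMeas M ℝ)

theorem specFamily_mono : Monotone (specFamily φ) := fun _ _ hst _ hx => le_trans hx hst

theorem specFamily_eq_bot {t : ℝ} (ht : t < -‖φ‖) : specFamily φ t = ⊥ := by
  refine Subtype.ext (Set.eq_empty_of_forall_notMem fun x (hx : φ.1 x ≤ t) => ?_)
  have := (abs_le.1 (BddMeas.norm_apply_le φ x)).1
  linarith

theorem specFamily_eq_top {t : ℝ} (ht : ‖φ‖ ≤ t) : specFamily φ t = ⊤ :=
  Subtype.ext (Set.eq_univ_of_forall fun x =>
    ((abs_le.1 (BddMeas.norm_apply_le φ x)).2.trans ht : φ.1 x ≤ t))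

theorem isBoundedSpectralFamily_specFamily : IsBoundedSpectralFamily (specFamily φ) :=
  isBoundedSpectralFamily_of_bounded (specFamily_mono φ)
    (fun _ _ h _ hx => le_of_forall_gt_imp_ge_of_dense fun s hs => h s hs hx)
    (fun _ => specFamily_eq_bot φ) (fun _ => specFamily_eq_top φ)

theorem isBoundedSpectralFamily_specFamilyQuot (x : MeasQuot ℝ I) :
    IsBoundedSpectralFamily (specFamilyQuot I x) := by
  obtain ⟨φ, rfl⟩ := Ideal.Quotient.mk_surjective x
  refine isBoundedSpectralFamily_of_bounded
    (fun s t hst => BoolQuotient.mk_mono (specFamily_mono φ hst)) (fun t => ?_)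
    (fun _ ht => congrArg (BoolQuotient.mk I.toIdeal) (specFamily_eq_bot φ ht))
    (fun _ ht => congrArg (BoolQuotient.mk I.toIdeal) (specFamily_eq_top φ ht))
  refine BoolQuotient.ind fun c h => ?_
  -- Right continuity only needs the sequence `t + 1 / (n + 1)`: the part of `c` where `φ > t` is
  -- covered by the countably many parts where `φ > t + 1 / (n + 1)`, all in the `σ`-ideal.
  have hn : ∀ n : ℕ, t < t + 1 / (n + 1 : ℝ) := fun n => by
    have : (0 : ℝ) < 1 / (n + 1 : ℝ) := Nat.one_div_pos_of_nat
    linarith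
  refine BoolQuotient.mk_le_mk.2 (I.lower (fun y hy => ?_)
    (I.iUnion_mem' _ fun n => BoolQuotient.mk_le_mk.1 (h _ (hn n))))
  obtain ⟨hyc, hyt⟩ : y ∈ (c : Set M) ∧ ¬ φ.1 y ≤ t := hy
  obtain ⟨n, hn⟩ := exists_nat_one_div_lt (sub_pos.2 (not_le.1 hyt))
  refine Set.mem_iUnion.2 ⟨n, hyc, fun h : φ.1 y ≤ _ => ?_⟩
  linarith

end SpectralFamily

/-! ### Quasipoints of the quotient -/

/-- The preimage of a quasipoint of the quotient in the algebra of measurable sets. -/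
noncomputable def comapQuasipoint (B : StoneSpectrum (QuotAlg I)) : quasipointsOver I :=
  ⟨StoneSpectrum.ofUltrafilter {a | BoolQuotient.mk I.toIdeal a ∈ B} B.top_mem
      (fun h ha => B.mem_of_le (BoolQuotient.mk_mono h) ha)
      (fun ha hb => B.inf_mem ha hb) B.bot_notMem
      (fun a => B.mem_or_compl_mem (BoolQuotient.mk I.toIdeal a)), by
    intro a ha
    have h : BoolQuotient.mk I.toIdeal a = ⊥ :=
      BoolQuotient.mk_eq_mk.2 (by rwa [symmDiff_bot])
    refine (B.compl_mem_iff (BoolQuotient.mk I.toIdeal a)).2 ?_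
    rw [h]
    exact B.bot_notMem⟩

theorem mem_comapQuasipoint {B : StoneSpectrum (QuotAlg I)} {a : MSet M} :
    a ∈ (comapQuasipoint I B).1 ↔ BoolQuotient.mk I.toIdeal a ∈ B := Iff.rfl

theorem continuous_comapQuasipoint : Continuous (comapQuasipoint I) := by
  refine Continuous.subtype_mk (continuous_generateFrom_iff.2 ?_) _
  rintro _ ⟨a, rfl⟩
  exact StoneSpectrum.isOpen_setOf_mem (BoolQuotient.mk I.toIdeal a)

theorem injective_comapQuasipoint : Function.Injective (comapQuasipoint I) := by
  intro B C h
  refine StoneSpectrum.ext (BoolQuotient.ind fun a => ?_)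
  rw [← mem_comapQuasipoint, h, mem_comapQuasipoint]

/-- Here `b` contains `a ⊓ (a \ b)ᶜ`, and `(a \ b)ᶜ` lies in `B`. So membership in `B` depends only
on the class, and `B` descends to the quotient. -/
theorem mem_of_mk_le_mk {B : StoneSpectrum (MSet M)} (hB : B ∈ quasipointsOver I) {a b : MSet M}
    (h : BoolQuotient.mk I.toIdeal a ≤ BoolQuotient.mk I.toIdeal b) (ha : a ∈ B) : b ∈ B := by
  refine B.mem_of_le ?_ (B.inf_mem ha (hB _ (BoolQuotient.mk_le_mk.1 h)))
  rw [compl_sdiff, himp_eq, inf_sup_left, inf_compl_self, sup_bot_eq]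
  exact inf_le_right

theorem surjective_comapQuasipoint : Function.Surjective (comapQuasipoint I) := by
  rintro ⟨B, hB⟩
  have hmem : ∀ a, (∃ b ∈ B, BoolQuotient.mk I.toIdeal b = BoolQuotient.mk I.toIdeal a) ↔ a ∈ B :=
    fun a => ⟨fun ⟨_, hb, h⟩ => mem_of_mk_le_mk I hB h.le hb, fun h => ⟨a, h, rfl⟩⟩
  refine ⟨StoneSpectrum.ofUltrafilter {x | ∃ b ∈ B, BoolQuotient.mk I.toIdeal b = x}
    ⟨⊤, B.top_mem, rfl⟩ ?_ ?_ ?_ ?_, ?_⟩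
  · rintro x y hxy ⟨a, ha, rfl⟩
    induction y using BoolQuotient.ind with | h b => exact ⟨b, mem_of_mk_le_mk I hB hxy ha, rfl⟩
  · rintro x y ⟨a, ha, rfl⟩ ⟨b, hb, rfl⟩
    exact ⟨a ⊓ b, B.inf_mem ha hb, rfl⟩
  · exact fun h => B.bot_notMem ((hmem ⊥).1 h)
  · refine BoolQuotient.ind fun a => (B.mem_or_compl_mem a).imp ?_ ?_ <;> exact fun h => ⟨_, h, rfl⟩
  · exact Subtype.ext (StoneSpectrum.ext hmem)

end Functions

end ClassicalObservables

theorem mainTheorem2 {M : Type*} [MeasurableSpace M] (I : SigmaIdeal M) :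
    -- classes of real functions are the selfadjoint part of the complex quotient algebra
    (Function.Injective (ofRealQuot I) ∧
      Set.range (ofRealQuot I) = {a : MeasQuot ℂ I | IsSelfAdjoint a}) ∧
    -- the families involved are bounded spectral families
    (∀ φ : BddMeas M ℝ, IsBoundedSpectralFamily (specFamily φ)) ∧
    (∀ x : MeasQuot ℝ I, IsBoundedSpectralFamily (specFamilyQuot I x)) ∧
    -- the Gelfand transformation on the selfadjoint part
    (∃ (θ : StoneSpectrum (QuotAlg I) ≃ₜ WeakDual.characterSpace ℂ (MeasQuot ℂ I))
        (Γ : MeasQuot ℝ I → C(StoneSpectrum (QuotAlg I), ℝ)),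
      (∀ x B, Γ x B = assocFun (specFamilyQuot I x) B) ∧
      ∀ x B, WeakDual.gelfandTransform ℂ (MeasQuot ℂ I) (ofRealQuot I x) (θ B) = (Γ x B : ℂ)) ∧
    -- the same map as the restriction of the Gelfand transformation of the function algebra
    (∃ (e : StoneSpectrum (QuotAlg I) ≃ₜ quasipointsOver I)
        (θ₀ : StoneSpectrum (MSet M) ≃ₜ WeakDual.characterSpace ℂ (BddMeas M ℂ)),
      (∀ (B : StoneSpectrum (QuotAlg I)) (a : MSet M),
        a ∈ (e B : StoneSpectrum (MSet M)) ↔ BoolQuotient.mk I.toIdeal a ∈ B) ∧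
      (∀ (φ : BddMeas M ℝ) (B : StoneSpectrum (MSet M)),
        WeakDual.gelfandTransform ℂ (BddMeas M ℂ) (ofRealMeas M φ) (θ₀ B) =
          (assocFun (specFamily φ) B : ℂ)) ∧
      ∀ (φ : BddMeas M ℝ) (B : StoneSpectrum (QuotAlg I)),
        assocFun (specFamilyQuot I (Ideal.Quotient.mk (vanishIdeal ℝ I) φ)) B =
          assocFun (specFamily φ) (e B : StoneSpectrum (MSet M))) := by
  have hI : ∀ x : MeasQuot ℂ I, IsSelfAdjoint x →
      ∃ E : ℝ → QuotAlg I, IsSpectralFor (indicatorQuot I) E x := fun x hx => by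
    obtain ⟨y, rfl⟩ := exists_ofRealQuot_eq I hx
    exact ⟨_, isSpectralFor_specFamilyQuot I y⟩
  have h₀ : ∀ x : BddMeas M ℂ, IsSelfAdjoint x →
      ∃ E : ℝ → MSet M, IsSpectralFor BddMeas.indicator E x := fun x hx => by
    obtain ⟨φ, rfl⟩ := BddMeas.exists_ofRealMeas_eq hx
    exact ⟨_, BddMeas.isSpectralFor_specFamily φ⟩
  let θ := (isFaithfulRep_indicatorQuot I).homeomorph hI
  have hθ : ∀ (x : MeasQuot ℝ I) (B : StoneSpectrum (QuotAlg I)),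
      WeakDual.gelfandTransform ℂ (MeasQuot ℂ I) (ofRealQuot I x) (θ B) =
        (assocFun (specFamilyQuot I x) B : ℂ) := fun x B =>
    (isFaithfulRep_indicatorQuot I).homeomorph_apply hI (isSpectralFor_specFamilyQuot I x) B
  -- Continuity is read off from the Gelfand transform through `θ`.
  have hcont : ∀ x : MeasQuot ℝ I, Continuous (assocFun (specFamilyQuot I x)) := fun x => by
    have h : assocFun (specFamilyQuot I x) = fun B =>
        (WeakDual.gelfandTransform ℂ (MeasQuot ℂ I) (ofRealQuot I x) (θ B)).re :=
      funext fun B => by rw [hθ, Complex.ofReal_re]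
    rw [h]
    exact Complex.continuous_re.comp ((ContinuousMap.continuous _).comp θ.continuous)
  have : CompactSpace (StoneSpectrum (QuotAlg I)) := θ.symm.compactSpace
  refine ⟨⟨injective_ofRealQuot I, range_ofRealQuot I⟩, isBoundedSpectralFamily_specFamily,
    isBoundedSpectralFamily_specFamilyQuot I, ⟨θ, fun x => ⟨_, hcont x⟩, fun _ _ => rfl, hθ⟩, ?_⟩
  -- The restriction formula is definitional: both infima run over the `t` for which the class of
  -- `specFamily φ t` lies in `B`.
  exact ⟨Continuous.homeoOfEquivCompactToT2
      (f := Equiv.ofBijective _ ⟨injective_comapQuasipoint I, surjective_comapQuasipoint I⟩)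
      (continuous_comapQuasipoint I),
    BddMeas.isFaithfulRep_indicator.homeomorph h₀, fun _ _ => Iff.rfl,
    fun φ B => BddMeas.isFaithfulRep_indicator.homeomorph_apply h₀
      (BddMeas.isSpectralFor_specFamily φ) B, fun _ _ => rfl⟩
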